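/- Let $(R,\mathfrak m)$ be a Noetherian local ring of Krull dimension $d\ge 1$ with infinite residue field, and let $\mathbf I=(I_1,\dots,I_s)$ be $\mathfrak m$-primary ideals of $R$. For $\mathbf n\in\mathbb Z^s$ put $\mathbf I^{\mathbf n}=I_1^{n_1}\cdots I_s^{n_s}$, with $I_i^{n_i}=R$ if $n_i\le 0$; put $\mathbf e=(1,\dots,1)$ and let $\mathbf e_i$ be the $i$-th unit vector; order $\mathbb Z^s$ componentwise. An $\mathbf I$-admissible filtration is a family $\mathcal F=\{\mathcal F(\mathbf n)\}_{\mathbf n\in\mathbb Z^s}$ of ideals of $R$ such that for all $\mathbf m,\mathbf n\in\mathbb Z^s$: $\mathbf I^{\mathbf n}\subseteq\mathcal F(\mathbf n)$; $\mathcal F(\mathbf n)\mathcal F(\mathbf m)\subseteq\mathcal F(\mathbf n+\mathbf m)$; $\mathcal F(\mathbf m)\subseteq\mathcal F(\mathbf n)$ if $\mathbf m\ge\mathbf n$; $\mathcal F(\mathbf n)=\mathcal F(\mathbf n^+)$, where $n_i^+=\max\{0,n_i\}$; and the extended Rees ring $\mathcal R'(\mathcal F)=\bigoplus_{\mathbf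 n\in\mathbb Z^s}\mathcal F(\mathbf n)\mathbf t^{\mathbf n}\subseteq R[t_1^{\pm1},\dots,t_s^{\pm1}]$ is a finite module over $\mathcal R'(\mathbf I)=\bigoplus_{\mathbf n\in\mathbb Z^s}\mathbf I^{\mathbf n}\mathbf t^{\mathbf n}$. Let $G(\mathcal F)=\bigoplus_{\mathbf n\in\mathbb N^s}\mathcal F(\mathbf n)/\mathcal F(\mathbf n+\mathbf e)$, a graded module over the ring $G(\mathbf I)=\bigoplus_{\mathbf n\in\mathbb N^s}\mathbf I^{\mathbf n}/\mathbf I^{\mathbf n+\mathbf e}$. For $a\in I_i$ let $a^*$ be its image in $G(\mathbf I)_{\mathbf e_i}=\mathbf I^{\mathbf e_i}/\mathbf I^{\mathbf e_i+\mathbf e}$. For an $\mathbb N^s$-graded ring $A$ and a graded $A$-module $M$, a sequence $b_1,\dots,b_r$ of homogeneous elements of $A$ is $M$-filter-regular if for each $k=1,\dots,r$ there is $\mathbf m\in\mathbb N^s$ such that, for all $\mathbf n\ge\mathbf m$, $b_k$ annihilates no nonzero element of degree $\mathbf n$ of $M/(b_1,\dots,b_{k-1})M$. Let $\mathcal F$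 be an $\mathbf I$-admissible filtration and let $\mathbf q=(q_1,\dots,q_s)\in\mathbb N^s$ with $q_1+\cdots+q_s=d$. Then there exist elements $a_{ij}\in I_i$ ($1\le i\le s$, $1\le j\le q_i$) which form a joint reduction of $\mathcal F$ of type $\mathbf q$, that is, there is $\mathbf m\in\mathbb N^s$ such that $$\sum_{i=1}^{s}\sum_{j=1}^{q_i}a_{ij}\,\mathcal F(\mathbf n-\mathbf e_i)=\mathcal F(\mathbf n)\quad\text{for all }\mathbf n\ge\mathbf m,$$ and such that $a^*_{11},\dots,a^*_{1q_1},\dots,a^*_{s1},\dots,a^*_{sq_s}$ (in this order) is a $G(\mathcal F)$-filter-regular sequence. -/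

import Mathlib

open scoped DirectSum

/-- The ideal `I^n = I₁^{n₁} ⋯ I_s^{n_s}` for `n ∈ ℤ^s`, where a nonpositive power of an ideal is
the unit ideal. -/
def multiPow {R : Type*} [CommRing R] {s : ℕ} (I : Fin s → Ideal R) (n : Fin s → ℤ) : Ideal R :=
  ∏ i, I i ^ (n i).toNat

theorem one_mem_multiPow_zero {R : Type*} [CommRing R] {s : ℕ} (I : Fin s → Ideal R) :
    (1 : R) ∈ multiPow I 0 := by
  have h : multiPow I 0 = 1 := Finset.prod_eq_one fun i _ => pow_zero (I i)
  rw [h, Ideal.one_eq_top]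
  exact Submodule.mem_top

/-- A `ℤ^s`-graded `I`-filtration of ideals of `R`. -/
structure MultiFiltration {R : Type*} [CommRing R] {s : ℕ} (I : Fin s → Ideal R) where
  /-- The ideals `F(n)`. -/
  toFun : (Fin s → ℤ) → Ideal R
  multiPow_le' : ∀ n, multiPow I n ≤ toFun n
  mul_le' : ∀ n m, toFun n * toFun m ≤ toFun (n + m)
  anti' : ∀ n m, n ≤ m → toFun m ≤ toFun n

namespace MultiFiltration

variable {R : Type*} [CommRing R] {s : ℕ} {I : Fin s → Ideal R}

instance : CoeFun (MultiFiltration I) (fun _ => (Fin s → ℤ) → Ideal R) := ⟨toFun⟩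

/-- The `I`-adic filtration `{I^n}`. -/
def adic (I : Fin s → Ideal R) : MultiFiltration I where
  toFun := multiPow I
  multiPow_le' _ := le_rfl
  mul_le' n m := by
    unfold multiPow
    rw [← Finset.prod_mul_distrib]
    refine Finset.prod_le_prod' fun i _ => ?_
    rw [← pow_add]
    refine Ideal.pow_le_pow_right ?_
    simp only [Pi.add_apply]
    omega
  anti' n m h := Finset.prod_le_prod' fun i _ =>
    Ideal.pow_le_pow_right (Int.toNat_le_toNat (h i))

/-! ### Extended Rees rings and admissible filtrations -/

/-- The extended Rees ring `R'(F) = ⨁_{n ∈ ℤ^s} F(n) t^n`, as a subring of the Laurent polynomial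
ring `R[t₁^{±1}, …, t_s^{±1}]`. -/
def extendedRees (F : MultiFiltration I) : Subring (AddMonoidAlgebra R (Fin s → ℤ)) where
  carrier := {f | ∀ n, f.coeff n ∈ F n}
  zero_mem' n := by simp
  one_mem' n := by
    classical
    rw [AddMonoidAlgebra.one_def, AddMonoidAlgebra.coeff_single, Finsupp.single_apply]
    split_ifs with h
    · subst h
      exact F.multiPow_le' 0 (one_mem_multiPow_zero I)
    · exact zero_mem _
  add_mem' {f g} hf hg n := by
    rw [AddMonoidAlgebra.coeff_add, Finsupp.add_apply]
    exact add_mem (hf n) (hg n)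
  neg_mem' {f} hf n := by
    rw [AddMonoidAlgebra.coeff_neg, Finsupp.neg_apply]
    exact neg_mem (hf n)
  mul_mem' {f g} hf hg n := by
    classical
    rw [AddMonoidAlgebra.coeff_mul]
    refine Ideal.sum_mem _ fun a _ => Ideal.sum_mem _ fun b _ => ?_
    dsimp only
    split_ifs with h
    · subst h
      exact F.mul_le' a b (Ideal.mul_mem_mul (hf a) (hg b))
    · exact zero_mem _

/-- The inclusion `R'(I) ⊆ R'(F)`. -/
theorem extendedRees_adic_le (F : MultiFiltration I) : (adic I).extendedRees ≤ F.extendedRees :=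
  fun _ hf n => F.multiPow_le' n (hf n)

/-- An `I`-filtration `F` is `I`-admissible if `F(n) = F(n⁺)` for all `n ∈ ℤ^s` and `R'(F)` is a
finite module over `R'(I)`. -/
structure IsAdmissible (F : MultiFiltration I) : Prop where
  eq_posPart : ∀ n : Fin s → ℤ, F n = F (fun i => max 0 (n i))
  finite : (Subring.inclusion F.extendedRees_adic_le).Finite

/-! ### Associated multigraded rings and modules -/

/-- The ideal `F(n)` for `n ∈ ℕ^s`. -/
def natIdeal (F : MultiFiltration I) (n : Fin s → ℕ) : Ideal R := F (fun i => (n i : ℤ))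

theorem natIdeal_mul_le (F : MultiFiltration I) (n m : Fin s → ℕ) :
    F.natIdeal n * F.natIdeal m ≤ F.natIdeal (n + m) := by
  refine (F.mul_le' _ _).trans (le_of_eq (congrArg F.toFun (funext fun i => ?_)))
  simp

theorem one_mem_natIdeal (F : MultiFiltration I) : (1 : R) ∈ F.natIdeal 0 :=
  F.multiPow_le' _ (one_mem_multiPow_zero I)

/-- The homogeneous component `F(n) / F(n + e)` of `G(F)`, where `e = (1, …, 1)`. -/
def Gr (F : MultiFiltration I) (n : Fin s → ℕ) : Type _ :=
  F.natIdeal n ⧸ (F.natIdeal (n + 1)).submoduleOf (F.natIdeal n)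

instance (F : MultiFiltration I) (n : Fin s → ℕ) : AddCommGroup (F.Gr n) :=
  Submodule.Quotient.addCommGroup ((F.natIdeal (n + 1)).submoduleOf (F.natIdeal n))

instance (F : MultiFiltration I) (n : Fin s → ℕ) : Module R (F.Gr n) :=
  Submodule.Quotient.module ((F.natIdeal (n + 1)).submoduleOf (F.natIdeal n))

/-- The class in `F(n) / F(n + e)` of an element of `F(n)`. -/
def grMk (F : MultiFiltration I) (n : Fin s → ℕ) : F.natIdeal n →ₗ[R] F.Gr n :=
  Submodule.mkQ ((F.natIdeal (n + 1)).submoduleOf (F.natIdeal n))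

theorem grMk_surjective (F : MultiFiltration I) (n : Fin s → ℕ) :
    Function.Surjective (F.grMk n) := Submodule.mkQ_surjective _

theorem grMk_eq_zero {F : MultiFiltration I} {n : Fin s → ℕ} {x : F.natIdeal n}
    (hx : (x : R) ∈ F.natIdeal (n + 1)) : F.grMk n x = 0 :=
  (Submodule.Quotient.mk_eq_zero _).2 hx

/-- For filtrations `E ⊆ F`, the multiplication
`E(n) / E(n + e) × F(m) / F(m + e) → F(n + m) / F(n + m + e)` induced by that of `R`. -/
def grMul {E F : MultiFiltration I} (h : ∀ n, E.natIdeal n ≤ F.natIdeal n) (n m : Fin s → ℕ) :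
    E.Gr n →ₗ[R] F.Gr m →ₗ[R] F.Gr (n + m) :=
  Submodule.liftQ _
    { toFun := fun x => Submodule.liftQ _
        { toFun := fun y => F.grMk (n + m) ⟨(x : R) * y,
            F.natIdeal_mul_le n m (Ideal.mul_mem_mul (h n x.2) y.2)⟩
          map_add' := fun y z => by
            rw [← map_add]
            exact congrArg _ (Subtype.ext (mul_add _ _ _))
          map_smul' := fun c y => by
            rw [← map_smul]
            exact congrArg _ (Subtype.ext (mul_left_comm _ _ _)) }
        (fun y hy => by
          refine grMk_eq_zero ?_
          rw [add_assoc]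
          exact F.natIdeal_mul_le n (m + 1) (Ideal.mul_mem_mul (h n x.2) hy))
      map_add' := fun x x' => by
        refine Submodule.linearMap_qext _ (LinearMap.ext fun y => ?_)
        change F.grMk (n + m) _ = F.grMk (n + m) _ + F.grMk (n + m) _
        rw [← map_add]
        exact congrArg _ (Subtype.ext (add_mul _ _ _))
      map_smul' := fun c x => by
        refine Submodule.linearMap_qext _ (LinearMap.ext fun y => ?_)
        change F.grMk (n + m) _ = c • F.grMk (n + m) _
        rw [← map_smul]
        exact congrArg _ (Subtype.ext (mul_assoc _ _ _)) }
    (fun x hx => by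
      refine Submodule.linearMap_qext _ (LinearMap.ext fun y => ?_)
      refine grMk_eq_zero ?_
      rw [add_right_comm]
      exact F.natIdeal_mul_le (n + 1) m (Ideal.mul_mem_mul (h (n + 1) hx) y.2))

theorem grMul_mk {E F : MultiFiltration I} (h : ∀ n, E.natIdeal n ≤ F.natIdeal n)
    (n m : Fin s → ℕ) (x : E.natIdeal n) (y : F.natIdeal m) :
    grMul h n m (E.grMk n x) (F.grMk m y) =
      F.grMk (n + m) ⟨(x : R) * y, F.natIdeal_mul_le n m (Ideal.mul_mem_mul (h n x.2) y.2)⟩ :=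
  rfl

theorem gradedMk_eq {F : MultiFiltration I} {n m : Fin s → ℕ} (hnm : n = m) {x : F.natIdeal n}
    {y : F.natIdeal m} (hxy : (x : R) = y) :
    GradedMonoid.mk (A := F.Gr) n (F.grMk n x) = GradedMonoid.mk m (F.grMk m y) := by
  subst hnm
  rw [Subtype.ext hxy]

instance gMul (I : Fin s → Ideal R) : GradedMonoid.GMul (adic I).Gr where
  mul {n m} x y := grMul (E := adic I) (F := adic I) (fun _ => le_rfl) n m x y

instance gOne (I : Fin s → Ideal R) : GradedMonoid.GOne (adic I).Gr where
  one := (adic I).grMk 0 ⟨1, (adic I).one_mem_natIdeal⟩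

instance gCommRing (I : Fin s → Ideal R) : DirectSum.GCommRing (adic I).Gr where
  mul_zero x := map_zero _
  zero_mul y := LinearMap.map_zero₂ (grMul (E := adic I) (F := adic I) (fun _ => le_rfl) _ _) y
  mul_add x y z := map_add _ _ _
  add_mul x y z := LinearMap.map_add₂ (grMul (E := adic I) (F := adic I) (fun _ => le_rfl) _ _) x y z
  one_mul := by
    rintro ⟨n, x⟩
    obtain ⟨x, rfl⟩ := (adic I).grMk_surjective n x
    exact gradedMk_eq (zero_add n) (one_mul _)
  mul_one := by
    rintro ⟨n, x⟩
    obtain ⟨x, rfl⟩ := (adic I).grMk_surjective n x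
    exact gradedMk_eq (add_zero n) (mul_one _)
  mul_assoc := by
    rintro ⟨n, x⟩ ⟨m, y⟩ ⟨k, z⟩
    obtain ⟨x, rfl⟩ := (adic I).grMk_surjective n x
    obtain ⟨y, rfl⟩ := (adic I).grMk_surjective m y
    obtain ⟨z, rfl⟩ := (adic I).grMk_surjective k z
    exact gradedMk_eq (add_assoc n m k) (mul_assoc _ _ _)
  mul_comm := by
    rintro ⟨n, x⟩ ⟨m, y⟩
    obtain ⟨x, rfl⟩ := (adic I).grMk_surjective n x
    obtain ⟨y, rfl⟩ := (adic I).grMk_surjective m y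
    exact gradedMk_eq (add_comm n m) (mul_comm _ _)
  natCast k := k • (adic I).grMk 0 ⟨1, (adic I).one_mem_natIdeal⟩
  natCast_zero := zero_nsmul _
  natCast_succ k := succ_nsmul _ _
  intCast k := k • (adic I).grMk 0 ⟨1, (adic I).one_mem_natIdeal⟩
  intCast_ofNat k := natCast_zsmul _ _
  intCast_negSucc_ofNat k := negSucc_zsmul _ _

instance gmodule (F : MultiFiltration I) : DirectSum.Gmodule (adic I).Gr F.Gr where
  smul {n m} x y := grMul (fun _ => F.multiPow_le' _) n m x y
  smul_zero x := map_zero _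
  zero_smul y := by rw [map_zero, LinearMap.zero_apply]
  smul_add x y z := map_add _ _ _
  add_smul x y z := by rw [map_add, LinearMap.add_apply]
  one_smul := by
    rintro ⟨n, x⟩
    obtain ⟨x, rfl⟩ := F.grMk_surjective n x
    exact gradedMk_eq (zero_add n) (one_mul _)
  mul_smul := by
    rintro ⟨n, x⟩ ⟨m, y⟩ ⟨k, z⟩
    obtain ⟨x, rfl⟩ := (adic I).grMk_surjective n x
    obtain ⟨y, rfl⟩ := (adic I).grMk_surjective m y
    obtain ⟨z, rfl⟩ := F.grMk_surjective k z
    exact gradedMk_eq (add_assoc n m k) (mul_assoc _ _ _)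

/-- The ring `G(I) = ⨁_{n ∈ ℕ^s} I^n / I^{n+e}`. -/
def AssocRing (I : Fin s → Ideal R) : Type _ := ⨁ n, (adic I).Gr n

instance (I : Fin s → Ideal R) : CommRing (AssocRing I) :=
  inferInstanceAs (CommRing (⨁ n, (adic I).Gr n))

/-- The `G(I)`-module `G(F) = ⨁_{n ∈ ℕ^s} F(n) / F(n + e)`. -/
def AssocModule (F : MultiFiltration I) : Type _ := ⨁ n, F.Gr n

instance (F : MultiFiltration I) : AddCommGroup F.AssocModule :=
  inferInstanceAs (AddCommGroup (⨁ n, F.Gr n))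

instance (F : MultiFiltration I) : Module (AssocRing I) F.AssocModule :=
  inferInstanceAs (Module (⨁ n, (adic I).Gr n) (⨁ n, F.Gr n))

/-- The inclusion of `G(I)_n = I^n / I^{n+e}` into `G(I)`. -/
def ringOf (I : Fin s → Ideal R) (n : Fin s → ℕ) : (adic I).Gr n →+ AssocRing I :=
  DirectSum.of (adic I).Gr n

/-- The inclusion of `G(F)_n = F(n) / F(n + e)` into `G(F)`. -/
def moduleOf (F : MultiFiltration I) (n : Fin s → ℕ) : F.Gr n →+ F.AssocModule :=
  DirectSum.of F.Gr n

/-- The homogeneous component of degree `n ∈ ℕ^s` of `G(I)`. -/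
def ringComponent (I : Fin s → Ideal R) (n : Fin s → ℕ) : AddSubgroup (AssocRing I) :=
  (ringOf I n).range

/-- The homogeneous component of degree `n ∈ ℕ^s` of `G(F)`. -/
def moduleComponent (F : MultiFiltration I) (n : Fin s → ℕ) : AddSubgroup F.AssocModule :=
  (moduleOf F n).range

theorem ringOf_mul_ringOf (I : Fin s → Ideal R) (n m : Fin s → ℕ)
    (x : (adic I).natIdeal n) (y : (adic I).natIdeal m) :
    ringOf I n ((adic I).grMk n x) * ringOf I m ((adic I).grMk m y) =
      ringOf I (n + m) ((adic I).grMk (n + m)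
        ⟨(x : R) * y, (adic I).natIdeal_mul_le n m (Ideal.mul_mem_mul x.2 y.2)⟩) :=
  DirectSum.of_mul_of _ _

theorem ringOf_smul_moduleOf (F : MultiFiltration I) (n m : Fin s → ℕ)
    (x : (adic I).natIdeal n) (y : F.natIdeal m) :
    ringOf I n ((adic I).grMk n x) • moduleOf F m (F.grMk m y) =
      moduleOf F (n + m) (F.grMk (n + m)
        ⟨(x : R) * y, F.natIdeal_mul_le n m (Ideal.mul_mem_mul (F.multiPow_le' _ x.2) y.2)⟩) :=
  DirectSum.Gmodule.of_smul_of _ _ _ _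

theorem le_natIdeal_single (I : Fin s → Ideal R) (i : Fin s) :
    I i ≤ (adic I).natIdeal (Pi.single i 1) := by
  refine le_of_eq ?_
  change I i = ∏ k, I k ^ (((Pi.single i 1 : Fin s → ℕ) k : ℤ)).toNat
  rw [Finset.prod_eq_single i]
  · simp
  · intro k _ hk
    simp [hk]
  · simp

/-- The image `a*` of `a ∈ I_i` in `G(I)_{e_i} = I_i / I_i I₁ ⋯ I_s`, as an element of `G(I)`. -/
noncomputable def initialForm (I : Fin s → Ideal R) (i : Fin s) (a : I i) :
    AssocRing I :=
  ringOf I (Pi.single i 1) ((adic I).grMk _ ⟨a, le_natIdeal_single I i a.2⟩)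

/-! ### Joint reductions -/

/-- The elements `a_{ij} ∈ I_i`, `1 ≤ j ≤ q_i`, form a joint reduction of `F` of type `q`:
`∑_{i,j} a_{ij} F(n - e_i) = F(n)` for all `n ≥ m`, for some `m ∈ ℕ^s`. -/
def IsJointReduction (F : MultiFiltration I) (q : Fin s → ℕ) (a : ∀ i, Fin (q i) → I i) : Prop :=
  ∃ m : Fin s → ℕ, ∀ n : Fin s → ℤ, (fun i => (m i : ℤ)) ≤ n →
    ∑ i, ∑ j, Ideal.span {(a i j : R)} * F (n - Pi.single i 1) = F n

end MultiFiltration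

/-! ### Filter-regular sequences -/

section FilterRegular

variable {A M : Type*} [CommRing A] [AddCommGroup M] [Module A M] {s : ℕ}

/-- An element `a` of an `ℕ^s`-graded ring, with components `𝒜`, is `M`-filter-regular, for a graded
module `M` with components `ℳ`, if it is homogeneous and `(0 :_M a)_n = 0` for all large `n`. -/
def IsFilterRegular (𝒜 : (Fin s → ℕ) → AddSubgroup A) (ℳ : (Fin s → ℕ) → AddSubgroup M)
    (a : A) : Prop :=
  SetLike.IsHomogeneousElem 𝒜 a ∧
    ∃ m : Fin s → ℕ, ∀ n, m ≤ n → ∀ x ∈ ℳ n, a • x = 0 → x = 0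

/-- The components of the graded module `M ⧸ N`, the images of those of `M`. -/
def quotientComponent (ℳ : (Fin s → ℕ) → AddSubgroup M) (N : Submodule A M) (n : Fin s → ℕ) :
    AddSubgroup (M ⧸ N) :=
  (ℳ n).map N.mkQ.toAddMonoidHom

/-- `a₁, …, a_r` is an `M`-filter-regular sequence if `a_k` is
`M ⧸ (a₁, …, a_{k-1})M`-filter-regular for all `k`. -/
def IsFilterRegularSequence (𝒜 : (Fin s → ℕ) → AddSubgroup A)
    (ℳ : (Fin s → ℕ) → AddSubgroup M) (as : List A) : Prop :=
  ∀ (k : ℕ) (hk : k < as.length),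
    IsFilterRegular 𝒜
      (quotientComponent ℳ (Ideal.ofList (as.take k) • (⊤ : Submodule A M))) as[k]

end FilterRegular

/-!
The elements `a_{ij}` are chosen one at a time so that their initial forms are `G(F)`-filter-regular,
and a count of lengths then shows that any such choice of `dim R` elements is a joint reduction.

*Existence of filter-regular forms.* Since `R'(F)` is finite over `R'(I)`, one has
`F(n + e_i) = I_i F(n)` once `n_i` is large (`IsAdmissible.exists_forall_le_mul`). Hence `G(F)` is a
finite module over the Noetherian ring `G(I)`, and in large degrees it lies in any given power of the
irrelevant ideal `𝔞 = ∏ G(I)_{e_i} G(I)`. Let `M` be the quotient of `G(F)` by the forms already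
chosen. Each associated prime of `M` not containing `𝔞` cuts out a proper submodule of `I_i`, so,
the residue field being infinite, some `a ∈ I_i` avoids all of them. The submodule `(0 :_M a*)` is
then killed by a power of `𝔞`, so by Artin–Rees it meets `𝔞 ^ c M` trivially for large `c`
(`Ideal.exists_pow_smul_top_smul_eq_zero`).

*Joint reduction.* In large degrees, the component of degree `n` of `G(F) / (a₁*, …, a_k*) G(F)` is
the quotient of `F(n)` by the ideal `F(n + e) + ∑ a_j F(n - e_{i_j})`, called `relIdeal` below.
Dividing by one more filter-regular form takes the difference of the Hilbert function in the
corresponding direction. If after `d = dim R` steps the quotient were nonzero in all large degrees,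
summing back would make the length of `F(n) / F(n + e)` grow at least like a polynomial of degree
`d` along the diagonal, and so that of `R / F(Ke)`, which is at most that of `R / (I₁ ⋯ I_s) ^ K`,
like one of degree `d + 1` (`exists_pow_le_hilbert`, `exists_le_relIdeal`). But the latter length is
`O(K ^ d)` by a system of parameters (`IsLocalRing.exists_length_quotient_pow_le`). Hence
`F(n) = F(n + e) + ∑ a_{ij} F(n - e_i)` in one large degree, and therefore in all larger ones;
`F(n + e)` is contained in `𝔪 F(n)` and is removed by Nakayama's lemma.
-/

/-! ### Avoidance and filter-regular elements -/

/-- A finite module over a local ring with infinite residue field is not a finite union of proper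
submodules: a proper submodule lies in a maximal one, whose quotient is the residue field, so it has
infinite index. -/
theorem Submodule.exists_forall_notMem_of_infinite_residueField {R V ι : Type*} [CommRing R]
    [IsLocalRing R] [AddCommGroup V] [Module R V] [Module.Finite R V]
    (hres : Infinite (IsLocalRing.ResidueField R)) (s : Finset ι) (p : ι → Submodule R V)
    (hp : ∀ i ∈ s, p i ≠ ⊤) : ∃ v : V, ∀ i ∈ s, v ∉ p i := by
  by_contra! hcon
  have hcov : ⋃ i ∈ s, (p i : Set V) = Set.univ := by
    ext v
    simpa using hcon v
  obtain ⟨i, hi, hfin⟩ := Submodule.exists_finiteIndex_of_cover hcov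
  obtain ⟨P, hP, hle⟩ := (eq_top_or_exists_le_coatom (p i)).resolve_left (hp i hi)
  have : Finite (V ⧸ p i) := AddSubgroup.finite_quotient_of_finiteIndex
  have : Finite (V ⧸ P) := Finite.of_surjective _ (Submodule.factor_surjective hle)
  have hsimple : IsSimpleModule R (V ⧸ P) := isSimpleModule_iff_isCoatom.2 hP
  obtain ⟨J, hJ, ⟨e⟩⟩ := isSimpleModule_iff_quot_maximal.1 hsimple
  obtain rfl := IsLocalRing.eq_maximalIdeal hJ
  have : Infinite (R ⧸ IsLocalRing.maximalIdeal R) := hres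
  exact not_finite_iff_infinite.2 this (Finite.of_equiv _ e.toEquiv)

/-- If `b` avoids every associated prime of `M` that does not contain `𝔞`, then multiplication by
`b` is injective on `𝔞 ^ c M` for large `c`: a power of `𝔞` kills `(0 :_M b)`, whose minimal primes
all contain `𝔞`, and the Artin–Rees lemma applies. -/
theorem Ideal.exists_pow_smul_top_smul_eq_zero {A M : Type*} [CommRing A] [IsNoetherianRing A]
    [AddCommGroup M] [Module A M] [Module.Finite A M] (𝔞 : Ideal A) (b : A)
    (hb : ∀ P ∈ associatedPrimes A M, ¬ 𝔞 ≤ P → b ∉ P) :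
    ∃ c : ℕ, ∀ x ∈ (𝔞 ^ c • ⊤ : Submodule A M), b • x = 0 → x = 0 := by
  let N : Submodule A M := LinearMap.ker (LinearMap.lsmul A M b)
  have hrad : 𝔞 ≤ (Module.annihilator A N).radical := by
    rw [← Ideal.sInf_minimalPrimes]
    refine le_sInf fun P hP => ?_
    have hP' := Module.associatedPrimes.minimalPrimes_annihilator_subset_associatedPrimes A N hP
    have hPM := associatedPrimes.subset_of_injective N.subtype_injective hP'
    by_contra hcon
    refine hb P hPM hcon (hP.1.2 (Module.mem_annihilator.2 fun x => Subtype.ext ?_))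
    exact x.2
  obtain ⟨t, ht⟩ := Ideal.exists_pow_le_of_le_radical_of_fg hrad (IsNoetherian.noetherian _)
  obtain ⟨k, hk⟩ := Ideal.exists_pow_inf_eq_pow_smul 𝔞 N
  refine ⟨t + k, fun x hx hbx => ?_⟩
  have hxN : x ∈ 𝔞 ^ (t + k) • ⊤ ⊓ N := ⟨hx, hbx⟩
  rw [hk _ (Nat.le_add_left k t), Nat.add_sub_cancel] at hxN
  have hle : 𝔞 ^ t • (𝔞 ^ k • ⊤ ⊓ N) ≤ (⊥ : Submodule A M) := by
    refine Submodule.smul_le.2 fun r hr y hy => ?_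
    exact congrArg Subtype.val (Module.mem_annihilator.1 (ht hr) ⟨y, hy.2⟩)
  exact hle hxN

namespace MultiFiltration

variable {R : Type*} [CommRing R] {s : ℕ} {I : Fin s → Ideal R}

/-! ### Consequences of admissibility -/

theorem multiPow_le_mul_sub_single (I : Fin s → Ideal R) {p : Fin s → ℤ} {i : Fin s}
    (hp : 1 ≤ p i) : multiPow I p ≤ I i * multiPow I (p - Pi.single i 1) := by
  have hsplit : ∀ n : Fin s → ℤ,
      multiPow I n = I i ^ (n i).toNat * ∏ k ∈ Finset.univ.erase i, I k ^ (n k).toNat :=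
    fun n => (Finset.mul_prod_erase _ (fun k => I k ^ (n k).toNat) (Finset.mem_univ i)).symm
  rw [hsplit, hsplit (p - Pi.single i 1), ← mul_assoc, ← pow_succ']
  refine Ideal.mul_mono (le_of_eq ?_) (Finset.prod_le_prod' fun k hk => le_of_eq ?_)
  · congr 1
    simp only [Pi.sub_apply, Pi.single_eq_same]
    omega
  · rw [Pi.sub_apply, Pi.single_eq_of_ne (Finset.ne_of_mem_erase hk), sub_zero]

/-- Beyond a bound `D` on the degrees of generators of `R'(F)` over `R'(I)`, a unit step in
direction `i` is multiplication by `I i`. -/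
theorem IsAdmissible.exists_forall_le_mul {F : MultiFiltration I} (hF : F.IsAdmissible) :
    ∃ D : ℕ, ∀ (n : Fin s → ℤ) (i : Fin s), (D : ℤ) ≤ n i →
      F (n + Pi.single i 1) ≤ I i * F n := by
  classical
  let _ := (Subring.inclusion F.extendedRees_adic_le).toAlgebra
  obtain ⟨S, hS⟩ : (⊤ : Submodule (adic I).extendedRees F.extendedRees).FG := hF.finite.fg_top
  let D : ℕ := S.sup fun f => f.1.coeff.support.sup fun p => Finset.univ.sup fun i => (p i).toNat
  have hD : ∀ f ∈ S, ∀ p, f.1.coeff p ≠ 0 → ∀ i, p i ≤ D := by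
    intro f hf p hp i
    have h1 : (p i).toNat ≤ Finset.univ.sup fun i => (p i).toNat :=
      Finset.le_sup (f := fun i => (p i).toNat) (Finset.mem_univ i)
    have h2 : (Finset.univ.sup fun i => (p i).toNat) ≤
        f.1.coeff.support.sup fun p => Finset.univ.sup fun i => (p i).toNat :=
      Finset.le_sup (f := fun p : Fin s → ℤ => Finset.univ.sup fun i => (p i).toNat)
        (Finsupp.mem_support_iff.2 hp)
    have h3 : (f.1.coeff.support.sup fun p => Finset.univ.sup fun i => (p i).toNat) ≤ D :=
      Finset.le_sup (f := fun f : F.extendedRees =>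
        f.1.coeff.support.sup fun p => Finset.univ.sup fun i => (p i).toNat) hf
    have := Int.self_le_toNat (p i)
    omega
  have key : ∀ h : F.extendedRees, ∀ (n : Fin s → ℤ) (i : Fin s), (D : ℤ) ≤ n i →
      h.1.coeff (n + Pi.single i 1) ∈ I i * F n := by
    intro h
    have hh : h ∈ Submodule.span (adic I).extendedRees (S : Set F.extendedRees) :=
      hS ▸ Submodule.mem_top
    induction hh using Submodule.span_induction with
    | mem f hf =>
      intro n i hn
      by_contra hne
      have h0 : f.1.coeff (n + Pi.single i 1) ≠ 0 := fun h0 => hne (h0 ▸ zero_mem _)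
      have := hD f hf _ h0 i
      simp only [Pi.add_apply, Pi.single_eq_same] at this
      omega
    | zero => intro n i _; exact zero_mem _
    | add f g _ _ hf hg =>
      intro n i hn
      exact add_mem (hf n i hn) (hg n i hn)
    | smul c f _ hf =>
      intro n i hn
      change (c.1 * f.1).coeff _ ∈ _
      rw [AddMonoidAlgebra.coeff_mul]
      refine Ideal.sum_mem _ fun p _ => Ideal.sum_mem _ fun p' _ => ?_
      dsimp only
      split_ifs with hpp
      · -- either the degree of `f` or that of the coefficient `c` is large in direction `i`
        by_cases hp' : (D : ℤ) + 1 ≤ p' i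
        · have h1 := hf (p' - Pi.single i 1) i (by simp; omega)
          rw [sub_add_cancel] at h1
          have h2 := Ideal.mul_mem_mul (F.multiPow_le' p (c.2 p)) h1
          rw [mul_left_comm] at h2
          refine Ideal.mul_mono_right ((F.mul_le' _ _).trans (le_of_eq ?_)) h2
          rw [← add_sub_assoc, hpp, add_sub_cancel_right]
        · have hsum : p i + p' i = n i + 1 := by simpa using congrFun hpp i
          have h1 := multiPow_le_mul_sub_single I (p := p) (i := i) (by omega) (c.2 p)
          have h2 := Ideal.mul_mem_mul h1 (f.2 p')
          rw [mul_assoc] at h2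
          refine Ideal.mul_mono_right ((Ideal.mul_mono_left (F.multiPow_le' _)).trans
            ((F.mul_le' _ _).trans (le_of_eq ?_))) h2
          rw [sub_add_eq_add_sub, hpp, add_sub_cancel_right]
      · exact zero_mem _
  refine ⟨D, fun n i hn x hx => ?_⟩
  have := key ⟨AddMonoidAlgebra.single (n + Pi.single i 1) x, fun p => ?_⟩ n i hn
  · simpa using this
  · rw [AddMonoidAlgebra.coeff_single, Finsupp.single_apply]
    split_ifs with h
    · exact h ▸ hx
    · exact zero_mem _

/-! ### Arithmetic of initial forms -/

/-- The structure map `R → G(I)`, with image the component of degree `0`. -/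
def ringOfScalar (I : Fin s → Ideal R) : R →+* AssocRing I where
  toFun r := ringOf I 0 ((adic I).grMk 0 ⟨r, by
    simpa using (adic I).natIdeal 0 |>.mul_mem_left r (adic I).one_mem_natIdeal⟩)
  map_one' := rfl
  map_mul' r t := by
    rw [ringOf_mul_ringOf]
    exact (DirectSum.of_eq_of_gradedMonoid_eq (gradedMk_eq (add_zero 0) rfl)).symm
  map_zero' := by
    rw [grMk_eq_zero (zero_mem _), map_zero]
  map_add' r t := by
    rw [← map_add, ← map_add]
    rfl

theorem initialForm_add (i : Fin s) (a b : I i) :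
    initialForm I i (a + b) = initialForm I i a + initialForm I i b := by
  unfold initialForm
  rw [← map_add, ← map_add]
  rfl

theorem ringOfScalar_mul_ringOf (r : R) (n : Fin s → ℕ) (x : (adic I).natIdeal n) :
    ringOfScalar I r * ringOf I n ((adic I).grMk n x) = ringOf I n ((adic I).grMk n (r • x)) := by
  refine (ringOf_mul_ringOf I _ _ _ _).trans ?_
  exact DirectSum.of_eq_of_gradedMonoid_eq (gradedMk_eq (zero_add n) rfl)

theorem initialForm_smul (i : Fin s) (r : R) (a : I i) :
    initialForm I i (r • a) = ringOfScalar I r * initialForm I i a :=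
  (ringOfScalar_mul_ringOf r (Pi.single i 1) ⟨a, le_natIdeal_single I i a.2⟩).symm

theorem ringOfScalar_smul_moduleOf (F : MultiFiltration I) (r : R) (n : Fin s → ℕ)
    (x : F.natIdeal n) :
    ringOfScalar I r • F.moduleOf n (F.grMk n x) = F.moduleOf n (F.grMk n (r • x)) := by
  refine (ringOf_smul_moduleOf F _ _ _ _).trans ?_
  exact DirectSum.of_eq_of_gradedMonoid_eq (gradedMk_eq (zero_add n) rfl)

theorem initialForm_smul_moduleOf (F : MultiFiltration I) (i : Fin s) (a : I i) (n : Fin s → ℕ)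
    (x : F.natIdeal n) :
    initialForm I i a • F.moduleOf n (F.grMk n x) =
      F.moduleOf (Pi.single i 1 + n) (F.grMk (Pi.single i 1 + n) ⟨(a : R) * x,
        F.natIdeal_mul_le _ n (Ideal.mul_mem_mul
          (F.multiPow_le' _ (le_natIdeal_single I i a.2)) x.2)⟩) :=
  ringOf_smul_moduleOf F _ _ _ _

end MultiFiltration

/-! ### Finiteness of the associated graded ring and module -/

/-- Strong induction on `ℕ^s` along unit steps. -/
theorem Pi.natInduction {s : ℕ} {P : (Fin s → ℕ) → Prop}
    (h : ∀ n, (∀ i m, n = Pi.single i 1 + m → P m) → P n) (n : Fin s → ℕ) : P n := by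
  induction hN : ∑ k, n k using Nat.strong_induction_on generalizing n with
  | _ N ih =>
    refine h n fun i m hnm => ih (∑ k, m k) ?_ m rfl
    rw [← hN, hnm]
    simp [Finset.sum_add_distrib]

theorem Pi.exists_eq_single_add {s : ℕ} {n : Fin s → ℕ} {i : Fin s} (hi : n i ≠ 0) :
    ∃ m : Fin s → ℕ, n = Pi.single i 1 + m := by
  refine ⟨n - Pi.single i 1, (add_tsub_cancel_of_le fun k => ?_).symm⟩
  by_cases hk : k = i
  · subst hk
    simpa using Nat.one_le_iff_ne_zero.2 hi
  · simp [hk]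

namespace MultiFiltration

variable {R : Type*} [CommRing R] {s : ℕ} {I : Fin s → Ideal R}

theorem natIdeal_adic_single_add (i : Fin s) (n : Fin s → ℕ) :
    (adic I).natIdeal (Pi.single i 1 + n) ≤ I i * (adic I).natIdeal n := by
  refine (multiPow_le_mul_sub_single I (i := i) (by simp)).trans (le_of_eq ?_)
  congr 2
  ext k
  by_cases hk : k = i
  · subst hk; simp
  · simp [hk]

theorem moduleOf_mem_of_le_mul {F : MultiFiltration I} {i : Fin s} {m n : Fin s → ℕ}
    (hn : n = Pi.single i 1 + m) (h : F.natIdeal n ≤ I i * F.natIdeal m)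
    (T : AddSubgroup F.AssocModule)
    (hT : ∀ a y, initialForm I i a • F.moduleOf m (F.grMk m y) ∈ T) (x : F.natIdeal n) :
    F.moduleOf n (F.grMk n x) ∈ T := by
  subst hn
  obtain ⟨x, hx⟩ := x
  have hx' := h hx
  induction hx' using Submodule.mul_induction_on' with
  | mem_mul_mem a ha y hy =>
    have := hT ⟨a, ha⟩ ⟨y, hy⟩
    rwa [initialForm_smul_moduleOf] at this
  | add x hx₁ y hy₁ ihx ihy =>
    have hle : I i * F.natIdeal m ≤ F.natIdeal (Pi.single i 1 + m) :=
      (Ideal.mul_mono_left ((le_natIdeal_single I i).trans (F.multiPow_le' _))).trans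
        (F.natIdeal_mul_le _ _)
    have := T.add_mem (ihx (hle hx₁)) (ihy (hle hy₁))
    rwa [← map_add, ← map_add] at this

theorem assocModule_induction {F : MultiFiltration I} {T : AddSubgroup F.AssocModule}
    (h : ∀ n x, F.moduleOf n (F.grMk n x) ∈ T) (z : F.AssocModule) : z ∈ T := by
  classical
  refine DirectSum.induction_on (motive := fun z : ⨁ n, F.Gr n => z ∈ T) z T.zero_mem
    (fun n x => ?_) fun x y hx hy => T.add_mem hx hy
  obtain ⟨x, rfl⟩ := F.grMk_surjective n x
  exact h n x

theorem assocRing_induction {T : Subring (AssocRing I)} (hR : ∀ r, ringOfScalar I r ∈ T)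
    (hI : ∀ i a, initialForm I i a ∈ T) (z : AssocRing I) : z ∈ T := by
  let T' : AddSubgroup (adic I).AssocModule := T.toAddSubgroup
  refine assocModule_induction (T := T') (fun n => ?_) z
  induction n using Pi.natInduction with
  | h n ih =>
    intro x
    by_cases hn : n = 0
    · subst hn
      exact hR x
    · obtain ⟨i, hi⟩ := Function.ne_iff.1 hn
      obtain ⟨m, rfl⟩ := Pi.exists_eq_single_add hi
      exact moduleOf_mem_of_le_mul rfl (natIdeal_adic_single_add i m) T'
        (fun a y => T.mul_mem (hI i a) (ih i m rfl y)) x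

/-- `G(I)` is generated over `R` by the forms of finite generating sets of the ideals `I i`. -/
instance [IsNoetherianRing R] : IsNoetherianRing (AssocRing I) := by
  choose g hg using fun i => IsNoetherian.noetherian (I i)
  have hmem : ∀ i (x : g i), (x : R) ∈ I i := fun i x => hg i ▸ Submodule.subset_span x.2
  let φ : MvPolynomial (Σ i, g i) R →+* AssocRing I := MvPolynomial.eval₂Hom (ringOfScalar I)
    fun κ => initialForm I κ.1 ⟨κ.2, hmem κ.1 κ.2⟩
  refine isNoetherianRing_of_surjective _ _ φ fun z => ?_
  have hC : ∀ r, ringOfScalar I r ∈ φ.range := fun r =>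
    ⟨MvPolynomial.C r, MvPolynomial.eval₂Hom_C _ _ _⟩
  refine assocRing_induction (T := φ.range) hC (fun i a => ?_) z
  obtain ⟨a, ha⟩ := a
  have ha' : a ∈ Submodule.span R (g i : Set R) := by rwa [hg]
  induction ha' using Submodule.span_induction with
  | mem x hx => exact ⟨MvPolynomial.X ⟨i, x, hx⟩, MvPolynomial.eval₂Hom_X' _ _ _⟩
  | zero =>
    have := initialForm_smul i (0 : R) (⟨0, ha⟩ : I i)
    rw [map_zero, zero_mul, zero_smul] at this
    exact this ▸ zero_mem _
  | add x y hx hy ihx ihy =>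
    rw [hg] at hx hy
    exact (initialForm_add i ⟨x, hx⟩ ⟨y, hy⟩) ▸ add_mem (ihx hx) (ihy hy)
  | smul r x hx ihx =>
    rw [hg] at hx
    exact (initialForm_smul i r ⟨x, hx⟩) ▸ mul_mem (hC r) (ihx hx)

theorem natIdeal_single_add_le {F : MultiFiltration I} {D : ℕ}
    (hD : ∀ (n : Fin s → ℤ) (i : Fin s), (D : ℤ) ≤ n i → F (n + Pi.single i 1) ≤ I i * F n)
    {i : Fin s} {n : Fin s → ℕ} (hn : D ≤ n i) :
    F.natIdeal (Pi.single i 1 + n) ≤ I i * F.natIdeal n := by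
  refine (le_of_eq ?_).trans (hD (fun k => (n k : ℤ)) i (by exact_mod_cast hn))
  unfold natIdeal
  congr 1
  ext k
  by_cases hk : k = i
  · subst hk; simp [add_comm]
  · simp [hk]

/-- For admissible `F`, the module `G(F)` is generated by its components in a bounded box of
degrees. -/
theorem IsAdmissible.finite_assocModule [IsNoetherianRing R] {F : MultiFiltration I}
    (hF : F.IsAdmissible) : Module.Finite (AssocRing I) F.AssocModule := by
  obtain ⟨D, hD⟩ := hF.exists_forall_le_mul
  let C : (Fin s → ℕ) → Submodule (AssocRing I) F.AssocModule := fun n =>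
    Submodule.span _ (Set.range fun x => F.moduleOf n (F.grMk n x))
  have hC : ∀ n, (C n).FG := fun n => by
    obtain ⟨S, hS⟩ := (IsNoetherian.noetherian (⊤ : Submodule R (F.natIdeal n)))
    classical
    refine ⟨S.image fun x => F.moduleOf n (F.grMk n x), le_antisymm
      (Submodule.span_mono (by simp)) (Submodule.span_le.2 ?_)⟩
    rintro _ ⟨x, rfl⟩
    have hx : x ∈ Submodule.span R (S : Set (F.natIdeal n)) := hS ▸ Submodule.mem_top
    dsimp only
    induction hx using Submodule.span_induction with
    | mem x hx => exact Submodule.subset_span (Finset.mem_coe.2 (Finset.mem_image_of_mem _ hx))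
    | zero => rw [map_zero, map_zero]; exact zero_mem _
    | add x y _ _ hx hy => rw [map_add, map_add]; exact add_mem hx hy
    | smul r x _ hx => rw [← ringOfScalar_smul_moduleOf]; exact Submodule.smul_mem _ _ hx
  refine ⟨?_⟩
  have htop : (⊤ : Submodule (AssocRing I) F.AssocModule) =
      ⨆ n ∈ Finset.Iic (fun _ : Fin s => D), C n := by
    refine (eq_top_iff.2 fun z _ => ?_).symm
    refine assocModule_induction
      (T := (⨆ n ∈ Finset.Iic (fun _ : Fin s => D), C n).toAddSubgroup) (fun n => ?_) z
    induction n using Pi.natInduction with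
    | h n ih =>
      intro x
      by_cases hn : n ≤ fun _ => D
      · exact (le_iSup₂_of_le n (Finset.mem_Iic.2 hn) le_rfl : C n ≤ _)
          (Submodule.subset_span ⟨x, rfl⟩)
      · simp only [Pi.le_def, not_forall, not_le] at hn
        obtain ⟨i, hi⟩ := hn
        obtain ⟨m, rfl⟩ := Pi.exists_eq_single_add (Nat.ne_zero_of_lt hi)
        refine moduleOf_mem_of_le_mul rfl (natIdeal_single_add_le hD ?_) _
          (fun a y => Submodule.smul_mem _ _ (ih i m rfl y)) x
        simp only [Pi.add_apply, Pi.single_eq_same] at hi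
        omega
  rw [htop]
  exact Submodule.fg_biSup _ _ fun n _ => hC n

/-! ### Existence of filter-regular elements -/

/-- The ideal of `G(I)` generated by the component `G(I)_{e_i}`. -/
def formIdeal (I : Fin s → Ideal R) (i : Fin s) : Ideal (AssocRing I) :=
  Ideal.span (Set.range (initialForm I i))

/-- In large degrees, `G(F)` lies in any prescribed power of the irrelevant ideal. -/
theorem IsAdmissible.exists_moduleOf_mem_pow_smul {F : MultiFiltration I} (hF : F.IsAdmissible) :
    ∃ D : ℕ, ∀ (c : ℕ) (n : Fin s → ℕ), (∀ i, D + c ≤ n i) → ∀ x,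
      F.moduleOf n (F.grMk n x) ∈
        ((∏ i, formIdeal I i) ^ c • ⊤ : Submodule (AssocRing I) F.AssocModule) := by
  obtain ⟨D, hD⟩ := hF.exists_forall_le_mul
  have key : ∀ (p n : Fin s → ℕ), (∀ i, n i = D + p i) → ∀ x, F.moduleOf n (F.grMk n x) ∈
        ((∏ i, formIdeal I i ^ p i) • ⊤ : Submodule (AssocRing I) F.AssocModule) := by
    intro p
    induction p using Pi.natInduction with
    | h p ih =>
      intro n hn x
      by_cases hp : p = 0
      · subst hp
        have h1 : ∏ k, formIdeal I k ^ (0 : Fin s → ℕ) k = ⊤ :=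
          (Finset.prod_eq_one fun k _ => pow_zero _).trans Ideal.one_eq_top
        rw [h1, Submodule.top_smul]
        exact Submodule.mem_top
      · obtain ⟨i, hi⟩ := Function.ne_iff.1 hp
        obtain ⟨m, rfl⟩ := Pi.exists_eq_single_add hi
        have hprod : ∏ k, formIdeal I k ^ (Pi.single i 1 + m : Fin s → ℕ) k =
            formIdeal I i * ∏ k, formIdeal I k ^ m k := by
          simp only [Pi.add_apply, pow_add, Finset.prod_mul_distrib]
          congr 1
          rw [Finset.prod_eq_single i (fun k _ hk => by simp [hk]) (by simp)]
          simp
        have hn' : n = Pi.single i 1 + fun k => D + m k := by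
          ext k
          rw [hn k]
          simp only [Pi.add_apply]
          omega
        rw [hprod, mul_smul]
        refine moduleOf_mem_of_le_mul hn' ?_ (formIdeal I i • (∏ k, formIdeal I k ^ m k) •
          (⊤ : Submodule (AssocRing I) F.AssocModule)).toAddSubgroup (fun a y => ?_) x
        · rw [hn']
          exact natIdeal_single_add_le hD (Nat.le_add_right _ _)
        · exact Submodule.smul_mem_smul (Ideal.subset_span ⟨a, rfl⟩) (ih i m rfl _ (fun _ => rfl) y)
  refine ⟨D, fun c n hn x => ?_⟩
  refine Submodule.smul_mono_left ?_ (key (fun i => n i - D) n (fun i => ?_) x)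
  · rw [← Finset.prod_pow]
    refine Finset.prod_le_prod' fun i _ => Ideal.pow_le_pow_right ?_
    have := hn i
    omega
  · have := hn i
    omega

/-- A filter-regular form exists in every direction: it is enough to avoid the associated primes
that do not contain the irrelevant ideal, and each of them cuts out a proper submodule of `I i`. -/
theorem IsAdmissible.exists_isFilterRegular_initialForm [IsLocalRing R] [IsNoetherianRing R]
    (hres : Infinite (IsLocalRing.ResidueField R)) {F : MultiFiltration I} (hF : F.IsAdmissible)
    (N : Submodule (AssocRing I) F.AssocModule) (i : Fin s) :
    ∃ a : I i, IsFilterRegular (ringComponent I) (quotientComponent F.moduleComponent N)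
      (initialForm I i a) := by
  have := hF.finite_assocModule
  let A := AssocRing I
  let 𝔞 : Ideal A := ∏ i, formIdeal I i
  have hfin := associatedPrimes.finite A (F.AssocModule ⧸ N)
  let W : Ideal A → Submodule R (I i) := fun P =>
    { carrier := {a | initialForm I i a ∈ P}
      add_mem' := fun {a b} ha hb => by
        change initialForm I i (a + b) ∈ P
        rw [initialForm_add]
        exact add_mem ha hb
      zero_mem' := by
        have := initialForm_smul i (0 : R) (0 : I i)
        rw [map_zero, zero_mul, zero_smul] at this
        change initialForm I i 0 ∈ P
        rw [this]
        exact zero_mem P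
      smul_mem' := fun r a ha => by
        change initialForm I i (r • a) ∈ P
        rw [initialForm_smul]
        exact P.mul_mem_left _ ha }
  classical
  obtain ⟨a, ha⟩ := Submodule.exists_forall_notMem_of_infinite_residueField hres
    (hfin.toFinset.filter fun P => ¬ 𝔞 ≤ P) W (by
      intro P hP htop
      refine (Finset.mem_filter.1 hP).2 ?_
      refine (Ideal.prod_le_inf.trans (Finset.inf_le (Finset.mem_univ i))).trans
        (Ideal.span_le.2 ?_)
      rintro _ ⟨a, rfl⟩
      exact (htop ▸ Submodule.mem_top : a ∈ W P))
  obtain ⟨c, hc⟩ := Ideal.exists_pow_smul_top_smul_eq_zero (M := F.AssocModule ⧸ N) 𝔞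
    (initialForm I i a) fun P hP hle =>
      ha P (Finset.mem_filter.2 ⟨hfin.mem_toFinset.2 hP, hle⟩)
  obtain ⟨D, hD⟩ := hF.exists_moduleOf_mem_pow_smul
  refine ⟨a, ⟨Pi.single i 1, _, rfl⟩, fun _ => D + c, fun n hn x hx => hc x ?_⟩
  obtain ⟨_, ⟨y, rfl⟩, rfl⟩ := hx
  obtain ⟨y, rfl⟩ := F.grMk_surjective n y
  have h := Submodule.mem_map_of_mem (f := N.mkQ) (hD c n hn y)
  rw [Submodule.map_smul''] at h
  exact Submodule.smul_mono le_rfl le_top h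

end MultiFiltration

/-! ### Lengths of subquotients -/

section Length

variable {R : Type*} [CommRing R]

/-- The length of `A / (A ∩ B)` for ideals `A` and `B`. -/
noncomputable def Ideal.relLength (A B : Ideal R) : ℕ∞ :=
  Module.length R (A ⧸ B.submoduleOf A)

theorem Ideal.relLength_add {A B C : Ideal R} (hBA : B ≤ A) (hCB : C ≤ B) :
    A.relLength C = B.relLength C + A.relLength B := by
  let f : (B ⧸ C.submoduleOf B) →ₗ[R] (A ⧸ C.submoduleOf A) :=
    Submodule.mapQ _ _ (Submodule.inclusion hBA) fun _ hx => hx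
  let g : (A ⧸ C.submoduleOf A) →ₗ[R] (A ⧸ B.submoduleOf A) :=
    Submodule.factor fun _ hx => hCB hx
  refine Module.length_eq_add_of_exact f g ?_ (Submodule.factor_surjective _) ?_
  · rw [← LinearMap.ker_eq_bot, LinearMap.ker_eq_bot']
    intro x hx
    obtain ⟨x, rfl⟩ := Submodule.mkQ_surjective _ x
    exact (Submodule.Quotient.mk_eq_zero _).2
      ((Submodule.Quotient.mk_eq_zero (C.submoduleOf A)).1 hx)
  · intro x
    obtain ⟨x, rfl⟩ := Submodule.mkQ_surjective _ x
    constructor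
    · intro hx
      exact ⟨Submodule.mkQ _ ⟨x, (Submodule.Quotient.mk_eq_zero (B.submoduleOf A)).1 hx⟩, rfl⟩
    · rintro ⟨y, hy⟩
      obtain ⟨y, rfl⟩ := Submodule.mkQ_surjective _ y
      rw [← hy]
      exact (Submodule.Quotient.mk_eq_zero _).2 y.2

theorem Ideal.relLength_anti {A B C : Ideal R} (hBA : B ≤ A) (hCB : C ≤ B) :
    A.relLength B ≤ A.relLength C :=
  Ideal.relLength_add hBA hCB ▸ le_add_self

/-- Multiplication by `a` compares subquotients as soon as it is injective modulo them. -/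
theorem Ideal.relLength_le_of_mul {A A' B B' : Ideal R} (a : R) (hA : ∀ x ∈ A', a * x ∈ A)
    (hB : ∀ x ∈ A', a * x ∈ B → x ∈ B') : A'.relLength B' ≤ A.relLength B := by
  let f : A' →ₗ[R] (A ⧸ B.submoduleOf A) :=
    (B.submoduleOf A).mkQ ∘ₗ (LinearMap.mulLeft R a).restrict hA
  have hker : LinearMap.ker f ≤ B'.submoduleOf A' := fun x hx =>
    hB x x.2 ((Submodule.Quotient.mk_eq_zero (B.submoduleOf A)).1 hx)
  calc A'.relLength B' ≤ Module.length R (A' ⧸ LinearMap.ker f) :=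
        Module.length_le_of_surjective _ (Submodule.factor_surjective hker)
    _ = Module.length R (LinearMap.range f) := f.quotKerEquivRange.length_eq
    _ ≤ _ := Module.length_le_of_injective _ (LinearMap.range f).subtype_injective

theorem Ideal.one_le_relLength {A B : Ideal R} (h : ¬ A ≤ B) : 1 ≤ A.relLength B := by
  rw [Order.one_le_iff_ne_zero, Ideal.relLength, ne_eq, Module.length_eq_zero_iff,
    Submodule.Quotient.subsingleton_iff, Submodule.submoduleOf_eq_top]
  exact h

theorem Ideal.top_relLength (B : Ideal R) :
    (⊤ : Ideal R).relLength B = Module.length R (R ⧸ B) :=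
  (Submodule.Quotient.equiv _ _ Submodule.topEquiv (by
    ext x
    simp [Submodule.submoduleOf])).length_eq

/-! ### Growth of powers of a primary ideal -/

theorem Ideal.length_quotient_span_mul_sup_le (x y : R) (L : Ideal R) :
    Module.length R (R ⧸ (Ideal.span {x * y} ⊔ L)) ≤
      Module.length R (R ⧸ (Ideal.span {x} ⊔ L)) + Module.length R (R ⧸ (Ideal.span {y} ⊔ L)) := by
  have hle : Ideal.span {x * y} ⊔ L ≤ Ideal.span {x} ⊔ L :=
    sup_le_sup_right (Ideal.span_singleton_le_span_singleton.2 ⟨y, rfl⟩) _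
  rw [← Ideal.top_relLength, ← Ideal.top_relLength (Ideal.span {x} ⊔ L),
    Ideal.relLength_add le_top hle, add_comm]
  gcongr
  have hx : x ∈ Ideal.span {x} ⊔ L := Ideal.mem_sup_left (Ideal.mem_span_singleton_self x)
  let B := Ideal.span {x} ⊔ L
  let C := Ideal.span {x * y} ⊔ L
  let f : R →ₗ[R] (B ⧸ C.submoduleOf B) := (C.submoduleOf B).mkQ ∘ₗ
    LinearMap.toSpanSingleton R B ⟨x, hx⟩
  have hf : Ideal.span {y} ⊔ L ≤ LinearMap.ker f := by
    refine sup_le ((Ideal.span_singleton_le_iff_mem _).2 ?_) fun z hz => ?_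
    · refine (Submodule.Quotient.mk_eq_zero _).2 (Ideal.mem_sup_left ?_)
      exact Ideal.mem_span_singleton.2 ⟨1, by simp [mul_comm]⟩
    · exact (Submodule.Quotient.mk_eq_zero _).2 (Ideal.mem_sup_right (L.mul_mem_right x hz))
  refine Module.length_le_of_surjective (Submodule.liftQ _ f hf) fun z => ?_
  obtain ⟨⟨z, hz⟩, rfl⟩ := Submodule.mkQ_surjective _ z
  obtain ⟨u, hu, v, hv, rfl⟩ := Submodule.mem_sup.1 hz
  obtain ⟨r, rfl⟩ := Ideal.mem_span_singleton'.1 hu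
  refine ⟨Submodule.Quotient.mk r, (Submodule.Quotient.eq _).2 ?_⟩
  refine Ideal.mem_sup_right ?_
  simpa using hv

theorem Ideal.length_quotient_span_pow_sup_le (x : R) (L : Ideal R) (N : ℕ) :
    Module.length R (R ⧸ (Ideal.span {x ^ N} ⊔ L)) ≤
      N * Module.length R (R ⧸ (Ideal.span {x} ⊔ L)) := by
  induction N with
  | zero =>
    have : Subsingleton (R ⧸ (Ideal.span {x ^ 0} ⊔ L)) := by
      rw [pow_zero, Ideal.span_singleton_one, top_sup_eq]
      exact Ideal.Quotient.subsingleton_iff.2 rfl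
    simp
  | succ N ih =>
    rw [pow_succ, Nat.cast_succ, add_mul, one_mul]
    exact (Ideal.length_quotient_span_mul_sup_le _ _ _).trans (add_le_add_left ih _)

theorem Ideal.length_quotient_span_image_pow_sup_le (t : Finset R) (N : ℕ) (L : Ideal R) :
    Module.length R (R ⧸ (Ideal.span ((fun x => x ^ N) '' (t : Set R)) ⊔ L)) ≤
      (N ^ t.card : ℕ) * Module.length R (R ⧸ (Ideal.span (t : Set R) ⊔ L)) := by
  classical
  induction t using Finset.induction_on generalizing L with
  | empty =>
    rw [Finset.coe_empty, Set.image_empty, Finset.card_empty, pow_zero, Nat.cast_one, one_mul]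
  | insert x t hx ih =>
    rw [Finset.coe_insert, Set.image_insert_eq, Ideal.span_insert, Ideal.span_insert,
      sup_assoc, Finset.card_insert_of_notMem hx, pow_succ', Nat.cast_mul, mul_assoc]
    refine (Ideal.length_quotient_span_pow_sup_le _ _ _).trans (mul_le_mul_right ?_ _)
    rw [sup_left_comm, sup_right_comm (Ideal.span {x}), sup_comm _ (Ideal.span (t : Set R))]
    exact ih _

/-- The length of `R / J ^ K` is bounded by a polynomial in `K` of degree `dim R`: by a system of
parameters `x₁, …, x_d`, it is at most the length of `R / (x₁ ^ N, …, x_d ^ N)` with `N`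
proportional to `K`. -/
theorem IsLocalRing.exists_length_quotient_pow_le [IsLocalRing R] [IsNoetherianRing R] {d : ℕ}
    (hdim : ringKrullDim R = d) (J : Ideal R) (hJ : J.radical = IsLocalRing.maximalIdeal R) :
    ∃ C : ℕ, ∀ K : ℕ, Module.length R (R ⧸ J ^ K) ≤ (C * K ^ d : ℕ) := by
  obtain ⟨t, ht, hcard⟩ :=
    (IsLocalRing.maximalIdeal R).exists_finset_card_eq_height_of_isNoetherianRing
  have hd : t.card = d := by
    rw [← IsLocalRing.maximalIdeal_height_eq_ringKrullDim, ← hcard] at hdim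
    exact_mod_cast hdim
  have : IsArtinianRing (R ⧸ Ideal.span (t : Set R)) :=
    IsLocalRing.quotient_artinian_of_mem_minimalPrimes_of_isLocalRing _ ht
  have hlen : Module.length R (R ⧸ Ideal.span (t : Set R)) ≠ ⊤ := by
    rw [Module.length_eq_of_surjective (M := R ⧸ Ideal.span (t : Set R))
      (R := R ⧸ Ideal.span (t : Set R)) (S := R) Ideal.Quotient.mk_surjective]
    exact Module.length_ne_top
  obtain ⟨e, he⟩ := ENat.ne_top_iff_exists.1 hlen
  obtain ⟨k, hk⟩ := Ideal.exists_pow_le_of_le_radical_of_fg hJ.ge (IsNoetherian.noetherian _)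
  refine ⟨k ^ d * e, fun K => ?_⟩
  have hle : Ideal.span ((fun x => x ^ (k * K)) '' (t : Set R)) ⊔ ⊥ ≤ J ^ K := by
    rw [sup_bot_eq, Ideal.span_le]
    rintro _ ⟨x, hx, rfl⟩
    have h1 := Ideal.pow_mem_pow (ht.1.2 (Ideal.subset_span hx)) (k * K)
    rw [pow_mul] at h1
    exact Ideal.pow_right_mono hk K h1
  refine (Module.length_le_of_surjective _ (Submodule.factor_surjective hle)).trans
    ((Ideal.length_quotient_span_image_pow_sup_le t _ _).trans (le_of_eq ?_))
  rw [sup_bot_eq, ← he, hd]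
  push_cast
  ring

end Length

namespace MultiFiltration

variable {R : Type*} [CommRing R] {s : ℕ} {I : Fin s → Ideal R}

/-! ### Components of quotients of the associated graded module -/

/-- The ideal `F(n + e) + ∑ a F(n - e_i)`, the sum over the elements `a ∈ I i` of the list `l`. For
large `n`, the component of degree `n` of `G(F) / (a* : a ∈ l) G(F)` is the quotient of `F(n)` by
this ideal. -/
def relIdeal (F : MultiFiltration I) (l : List (Σ i, I i)) (n : Fin s → ℤ) : Ideal R :=
  F (n + 1) ⊔ ⨆ p ∈ l, Ideal.span {(p.2 : R)} * F (n - Pi.single p.1 1)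

/-- The submodule of `G(F)` generated by the initial forms of the elements of `l`. -/
noncomputable def formSubmodule (F : MultiFiltration I) (l : List (Σ i, I i)) :
    Submodule (AssocRing I) F.AssocModule :=
  Ideal.ofList (l.map fun p => initialForm I p.1 p.2) • ⊤

theorem le_relIdeal (F : MultiFiltration I) (l : List (Σ i, I i)) (n : Fin s → ℤ) :
    F (n + 1) ≤ F.relIdeal l n := le_sup_left

theorem span_mul_le_relIdeal (F : MultiFiltration I) {l : List (Σ i, I i)} {p : Σ i, I i}
    (hp : p ∈ l) (n : Fin s → ℤ) :
    Ideal.span {(p.2 : R)} * F (n - Pi.single p.1 1) ≤ F.relIdeal l n :=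
  le_sup_of_le_right (le_iSup₂_of_le p hp le_rfl)

theorem le_toFun_single (F : MultiFiltration I) (i : Fin s) : I i ≤ F (Pi.single i 1) := by
  refine ((le_natIdeal_single I i).trans (F.multiPow_le' _)).trans (le_of_eq ?_)
  congr 1
  ext k
  by_cases hk : k = i
  · subst hk; simp
  · simp [hk]

theorem span_mul_le (F : MultiFiltration I) (p : Σ i, I i) (n : Fin s → ℤ) :
    Ideal.span {(p.2 : R)} * F (n - Pi.single p.1 1) ≤ F n := by
  refine (Ideal.mul_mono_left (((Ideal.span_singleton_le_iff_mem _).2 p.2.2).trans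
    (F.le_toFun_single p.1))).trans ((F.mul_le' _ _).trans (le_of_eq ?_))
  rw [add_sub_cancel]

theorem relIdeal_le (F : MultiFiltration I) (l : List (Σ i, I i)) (n : Fin s → ℤ) :
    F.relIdeal l n ≤ F n :=
  sup_le (F.anti' _ _ (le_add_of_nonneg_right zero_le_one))
    (iSup₂_le fun p _ => F.span_mul_le p n)

theorem relIdeal_append_singleton (F : MultiFiltration I) (l : List (Σ i, I i)) (p : Σ i, I i)
    (n : Fin s → ℤ) : F.relIdeal (l ++ [p]) n =
      F.relIdeal l n ⊔ Ideal.span {(p.2 : R)} * F (n - Pi.single p.1 1) := by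
  refine le_antisymm (sup_le (le_sup_of_le_left (F.le_relIdeal l n)) (iSup₂_le fun t ht => ?_))
    (sup_le (sup_le (F.le_relIdeal _ n) (iSup₂_le fun t ht => ?_)) ?_)
  · rcases List.mem_append.1 ht with ht | ht
    · exact le_sup_of_le_left (F.span_mul_le_relIdeal ht n)
    · obtain rfl := List.mem_singleton.1 ht
      exact le_sup_right
  · exact F.span_mul_le_relIdeal (List.mem_append_left _ ht) n
  · exact F.span_mul_le_relIdeal (List.mem_append_right _ (List.mem_singleton_self p)) n

/-- The submodule generated by the forms is homogeneous: it lies in the additive group of those `z`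
whose component in each degree `n` is the class of an element of `relIdeal l n`. -/
theorem coe_mem_relIdeal_of_moduleOf_mem {F : MultiFiltration I} {l : List (Σ i, I i)}
    {n : Fin s → ℕ} {y : F.natIdeal n} (hy : F.moduleOf n (F.grMk n y) ∈ F.formSubmodule l) :
    (y : R) ∈ F.relIdeal l fun k => n k := by
  classical
  let ev : ∀ n, F.AssocModule →+ F.Gr n := fun n => DFinsupp.evalAddMonoidHom n
  let Q : ∀ n, AddSubgroup (F.Gr n) := fun n =>
    ((F.relIdeal l fun k => n k).submoduleOf (F.natIdeal n)).toAddSubgroup.map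
      (F.grMk n).toAddMonoidHom
  let T : AddSubgroup F.AssocModule := ⨅ n, (Q n).comap (ev n)
  have hT : ∀ {n} {y : F.natIdeal n}, (y : R) ∈ F.relIdeal l (fun k => n k) →
      F.moduleOf n (F.grMk n y) ∈ T := by
    intro n y hy
    refine AddSubgroup.mem_iInf.2 fun m => ?_
    change DirectSum.of F.Gr n (F.grMk n y) m ∈ Q m
    by_cases hmn : n = m
    · subst hmn
      rw [DirectSum.of_eq_same]
      exact ⟨y, hy, rfl⟩
    · rw [DirectSum.of_eq_of_ne _ _ _ (Ne.symm hmn)]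
      exact zero_mem _
  have hle : ∀ z ∈ F.formSubmodule l, z ∈ T := by
    intro z hz
    refine Submodule.smul_induction_on hz (fun r hr m _ => ?_) fun x y hx hy => T.add_mem hx hy
    induction hr using Submodule.span_induction generalizing m with
    | mem r hr =>
      obtain ⟨p, hp, rfl⟩ := List.mem_map.1 hr
      refine assocModule_induction
        (T := T.comap (DistribSMul.toAddMonoidHom F.AssocModule (initialForm I p.1 p.2)))
        (fun n y => ?_) m
      change initialForm I p.1 p.2 • F.moduleOf n (F.grMk n y) ∈ T
      rw [initialForm_smul_moduleOf]
      refine hT (F.span_mul_le_relIdeal hp _ (Ideal.mul_mem_mul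
        (Ideal.mem_span_singleton_self _) ?_))
      convert! y.2 using 1
      unfold natIdeal
      congr 1
      ext k
      by_cases hk : k = p.1
      · subst hk; simp
      · simp [hk]
    | zero => rw [zero_smul]; exact zero_mem _
    | add r t _ _ ihr iht => rw [add_smul]; exact T.add_mem (ihr m trivial) (iht m trivial)
    | smul c r _ ih =>
      rw [smul_eq_mul, mul_comm, mul_smul]
      exact ih (c • m) trivial
  have h := AddSubgroup.mem_iInf.1 (hle _ hy) n
  change DirectSum.of F.Gr n (F.grMk n y) n ∈ Q n at h
  rw [DirectSum.of_eq_same] at h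
  obtain ⟨x, hx, hxy⟩ := h
  have hxy' : F.grMk n (y - x) = 0 := by
    rw [map_sub, sub_eq_zero]
    exact hxy.symm
  have hsub : (y : R) - x ∈ F.natIdeal (n + 1) :=
    (Submodule.Quotient.mk_eq_zero ((F.natIdeal (n + 1)).submoduleOf (F.natIdeal n))).1 hxy'
  have := add_mem (F.le_relIdeal l (fun k => n k) (by convert! hsub using 1)) hx
  simpa using this

theorem moduleOf_mem_of_coe_mem_relIdeal {F : MultiFiltration I} {l : List (Σ i, I i)}
    {n : Fin s → ℕ} (hn : ∀ k, n k ≠ 0) {y : F.natIdeal n}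
    (hy : (y : R) ∈ F.relIdeal l fun k => n k) :
    F.moduleOf n (F.grMk n y) ∈ F.formSubmodule l := by
  let W : Ideal R :=
    { carrier := {w | ∃ h : w ∈ F.natIdeal n, F.moduleOf n (F.grMk n ⟨w, h⟩) ∈ F.formSubmodule l}
      add_mem' := by
        rintro v w ⟨hv, hv'⟩ ⟨hw, hw'⟩
        refine ⟨add_mem hv hw, ?_⟩
        have := add_mem hv' hw'
        rwa [← map_add, ← map_add] at this
      zero_mem' := ⟨zero_mem _, by
        rw [grMk_eq_zero (zero_mem _), map_zero]
        exact zero_mem _⟩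
      smul_mem' := by
        rintro r w ⟨hw, hw'⟩
        refine ⟨Ideal.mul_mem_left _ r hw, ?_⟩
        have := Submodule.smul_mem _ (ringOfScalar I r) hw'
        rwa [ringOfScalar_smul_moduleOf] at this }
  suffices h : F.relIdeal l (fun k => n k) ≤ W from (h hy).2
  refine sup_le (fun w hw => ?_) (iSup₂_le fun p hp => ?_)
  · have hw1 : w ∈ F.natIdeal (n + 1) := by
      convert! hw using 1
    refine ⟨F.anti' _ _ (le_add_of_nonneg_right zero_le_one) hw, ?_⟩
    rw [grMk_eq_zero hw1, map_zero]
    exact zero_mem _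
  · obtain ⟨m, rfl⟩ := Pi.exists_eq_single_add (hn p.1)
    intro w hw
    obtain ⟨z, hz, rfl⟩ := Ideal.mem_span_singleton_mul.1 hw
    have hz' : z ∈ F.natIdeal m := by
      convert! hz using 1
      unfold natIdeal
      congr 1
      ext k
      by_cases hk : k = p.1
      · subst hk; simp
      · simp [hk]
    have hmem : initialForm I p.1 p.2 • F.moduleOf m (F.grMk m ⟨z, hz'⟩) ∈ F.formSubmodule l :=
      Submodule.smul_mem_smul (Ideal.subset_span (List.mem_map.2 ⟨p, hp, rfl⟩)) trivial
    rw [initialForm_smul_moduleOf] at hmem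
    exact ⟨_, hmem⟩

/-- Multiplication by the element `a ∈ I i` of the pair `p = ⟨i, a⟩` is injective, in large degrees,
from `F(n) / relIdeal l n` to `F(n + e_i) / relIdeal l (n + e_i)`. -/
def IsEventuallyRegular (F : MultiFiltration I) (l : List (Σ i, I i)) (p : Σ i, I i) : Prop :=
  ∃ m : ℕ, ∀ n : Fin s → ℤ, (∀ k, (m : ℤ) ≤ n k) → ∀ y ∈ F n,
    (p.2 : R) * y ∈ F.relIdeal l (n + Pi.single p.1 1) → y ∈ F.relIdeal l n

theorem isEventuallyRegular_of_isFilterRegular {F : MultiFiltration I} {l : List (Σ i, I i)}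
    {p : Σ i, I i} (h : IsFilterRegular (ringComponent I)
      (quotientComponent F.moduleComponent (F.formSubmodule l)) (initialForm I p.1 p.2)) :
    F.IsEventuallyRegular l p := by
  obtain ⟨-, m, hm⟩ := h
  obtain ⟨M, hM⟩ : ∃ M : ℕ, ∀ k, m k ≤ M :=
    ⟨_, fun k => Finset.single_le_sum (fun _ _ => Nat.zero_le _) (Finset.mem_univ k)⟩
  refine ⟨M + 1, fun n hn y hy hay => ?_⟩
  lift n to Fin s → ℕ using fun k => by have := hn k; omega
  have hn' : ∀ k, m k + 1 ≤ n k := fun k => by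
    have h1 := hn k
    have h2 := hM k
    push_cast at h1
    omega
  refine coe_mem_relIdeal_of_moduleOf_mem (y := ⟨y, hy⟩) ?_
  rw [← Submodule.Quotient.mk_eq_zero]
  refine hm n (fun k => (Nat.le_succ _).trans (hn' k)) _ ⟨_, ⟨_, rfl⟩, rfl⟩ ?_
  rw [← Submodule.Quotient.mk_smul, Submodule.Quotient.mk_eq_zero, initialForm_smul_moduleOf]
  refine moduleOf_mem_of_coe_mem_relIdeal (fun k => ?_) ?_
  · have := hn' k
    simp only [Pi.add_apply]
    omega
  · convert! hay using 2
    ext k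
    by_cases hk : k = p.1
    · subst hk; simp [add_comm]
    · simp [hk]

/-! ### Growth of lengths -/

/-- The length of `F(n)` modulo `relIdeal l n`, which for large `n` is the Hilbert function of
`G(F) / (a* : a ∈ l) G(F)`. -/
noncomputable def hilbert (F : MultiFiltration I) (l : List (Σ i, I i)) (n : Fin s → ℤ) : ℕ∞ :=
  (F n).relLength (F.relIdeal l n)

/-- Adding an eventually regular element to the list takes the difference of the Hilbert function
in its direction. -/
theorem IsEventuallyRegular.exists_hilbert_add_le {F : MultiFiltration I} {l : List (Σ i, I i)}
    {p : Σ i, I i} (h : F.IsEventuallyRegular l p) :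
    ∃ m : ℕ, ∀ n : Fin s → ℤ, (∀ k, (m : ℤ) ≤ n k) →
      F.hilbert l (n - Pi.single p.1 1) + F.hilbert (l ++ [p]) n ≤ F.hilbert l n := by
  obtain ⟨m, hm⟩ := h
  refine ⟨m + 1, fun n hn => ?_⟩
  have happ := F.relIdeal_append_singleton l p n
  have hle : F.relIdeal l n ≤ F.relIdeal (l ++ [p]) n := happ ▸ le_sup_left
  unfold hilbert
  rw [Ideal.relLength_add (F.relIdeal_le (l ++ [p]) n) hle]
  gcongr
  refine Ideal.relLength_le_of_mul (p.2 : R) (fun x hx => ?_) fun x hx hax => ?_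
  · rw [happ]
    exact Ideal.mem_sup_right (Ideal.mul_mem_mul (Ideal.mem_span_singleton_self _) hx)
  · refine hm _ (fun k => ?_) x hx (by rwa [sub_add_cancel])
    have := hn k
    have h1 : (Pi.single p.1 1 : Fin s → ℤ) k ≤ 1 := by
      by_cases hk : k = p.1
      · subst hk; simp
      · simp [hk]
    rw [Pi.sub_apply]
    push_cast at this
    omega

/-- If the Hilbert function does not vanish in large degrees after dividing out `l₂`, then before
that it grows at least like a polynomial of degree the length of `l₂`. -/
theorem exists_pow_le_hilbert {F : MultiFiltration I} (l₂ l : List (Σ i, I i))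
    (hreg : ∀ l₁ p l₃, l₂ = l₁ ++ p :: l₃ → F.IsEventuallyRegular (l ++ l₁) p)
    (hpos : ∃ m : ℕ, ∀ n : Fin s → ℤ, (∀ k, (m : ℤ) ≤ n k) → 1 ≤ F.hilbert (l ++ l₂) n) :
    ∃ m c : ℕ, ∀ (j : ℕ) (n : Fin s → ℤ), (∀ k, ((m + c * j : ℕ) : ℤ) ≤ n k) →
      ((j ^ l₂.length : ℕ) : ℕ∞) ≤ F.hilbert l n := by
  induction l₂ generalizing l with
  | nil =>
    obtain ⟨m, hm⟩ := hpos
    refine ⟨m, 0, fun j n hn => ?_⟩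
    rw [List.length_nil, pow_zero, Nat.cast_one]
    simpa using hm n (by simpa using hn)
  | cons p l₂ ih =>
    obtain ⟨m, c, hmc⟩ := ih (l ++ [p]) (fun l₁ t l₃ h => by
      have := hreg (p :: l₁) t l₃ (by rw [h]; rfl)
      simpa using this) (by simpa using hpos)
    obtain ⟨m', hm'⟩ := (hreg [] p l₂ rfl).exists_hilbert_add_le
    rw [List.append_nil] at hm'
    have key : ∀ (j t : ℕ) (n : Fin s → ℤ), (∀ k, ((m + m' + c * j + t : ℕ) : ℤ) ≤ n k) →
        ((t * j ^ l₂.length : ℕ) : ℕ∞) ≤ F.hilbert l n := by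
      intro j t
      induction t with
      | zero => intro n _; simp
      | succ t iht =>
        intro n hn
        have h1 := iht (n - Pi.single p.1 1) fun k => by
          have := hn k
          have h1 : (Pi.single p.1 1 : Fin s → ℤ) k ≤ 1 := by
            by_cases hk : k = p.1
            · subst hk; simp
            · simp [hk]
          rw [Pi.sub_apply]
          push_cast at this ⊢
          linarith
        have h2 := hmc j n fun k => by
          have := hn k
          push_cast at this ⊢
          linarith
        have h3 := hm' n fun k => by
          have := hn k
          have : (0 : ℤ) ≤ c * j := by positivity
          push_cast at *
          linarith
        rw [Nat.succ_mul, Nat.cast_add]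
        exact (add_le_add h1 h2).trans h3
    refine ⟨m + m', c + 1, fun j n hn => ?_⟩
    rw [List.length_cons, pow_succ']
    refine key j j n fun k => ?_
    have := hn k
    push_cast at this ⊢
    linarith

theorem relIdeal_nil (F : MultiFiltration I) (n : Fin s → ℤ) : F.relIdeal [] n = F (n + 1) := by
  simp [relIdeal]

end MultiFiltration

namespace MultiFiltration

variable {R : Type*} [CommRing R] {s : ℕ} {I : Fin s → Ideal R}

/-! ### The joint reduction -/

theorem multiPow_const (I : Fin s → Ideal R) (K : ℕ) :
    multiPow I (fun _ => (K : ℤ)) = (∏ i, I i) ^ K := by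
  simp [multiPow, Finset.prod_pow]

/-- Summing `ℓ(F(n) / F(n + e))` along the diagonal. -/
theorem mul_le_relLength_of_le_hilbert {F : MultiFiltration I} {N : ℕ} {a : ℕ∞}
    (h : ∀ n : ℕ, N ≤ n → a ≤ F.hilbert [] fun _ => (n : ℤ)) (t : ℕ) :
    t * a ≤ (⊤ : Ideal R).relLength (F fun _ => ((N + t : ℕ) : ℤ)) := by
  induction t with
  | zero => simp
  | succ t ih =>
    have h1 := h (N + t) (Nat.le_add_right _ _)
    rw [hilbert, relIdeal_nil] at h1
    have hle : F ((fun _ => ((N + t : ℕ) : ℤ)) + 1) ≤ F fun _ => ((N + t : ℕ) : ℤ) :=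
      F.anti' _ _ (le_add_of_nonneg_right zero_le_one)
    have hsucc : (fun _ : Fin s => ((N + (t + 1) : ℕ) : ℤ)) = (fun _ => ((N + t : ℕ) : ℤ)) + 1 := by
      ext k
      simp [add_assoc]
    rw [hsucc, Ideal.relLength_add le_top hle, Nat.cast_succ, add_mul, one_mul, add_comm]
    exact add_le_add h1 ih

/-- A list of `dim R` successively regular elements annihilates the Hilbert function in arbitrarily
large degrees: otherwise the length of `R / F(Ke)`, hence that of `R / (I₁ ⋯ I_s) ^ K`, would grow
at least like `K ^ (dim R + 1)`. -/
theorem exists_le_relIdeal [IsLocalRing R] [IsNoetherianRing R] {d : ℕ}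
    (hdim : ringKrullDim R = d) (hs : 0 < s)
    (hI : ∀ i, (I i).radical = IsLocalRing.maximalIdeal R)
    (F : MultiFiltration I) {l : List (Σ i, I i)} (hl : l.length = d)
    (hreg : ∀ l₁ p l₃, l = l₁ ++ p :: l₃ → F.IsEventuallyRegular l₁ p) (D : ℕ) :
    ∃ n : Fin s → ℤ, (∀ k, (D : ℤ) ≤ n k) ∧ F n ≤ F.relIdeal l n := by
  by_contra! hcon
  obtain ⟨m, c, hmc⟩ := exists_pow_le_hilbert (F := F) l [] (by simpa using hreg)
    ⟨D, fun n hn => Ideal.one_le_relLength (hcon n hn)⟩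
  have hJ : (∏ i, I i).radical = IsLocalRing.maximalIdeal R := by
    refine le_antisymm ?_ (Finset.prod_induction I
      (fun J => IsLocalRing.maximalIdeal R ≤ J.radical) (fun J K hJ hK => ?_) ?_ fun i _ => (hI i).ge)
    · rw [← hI ⟨0, hs⟩]
      exact Ideal.radical_mono (Ideal.prod_le_inf.trans (Finset.inf_le (Finset.mem_univ _)))
    · exact (le_inf hJ hK).trans (Ideal.radical_mul J K).ge
    · rw [Ideal.one_eq_top, Ideal.radical_top]
      exact le_top
  obtain ⟨C, hC⟩ := IsLocalRing.exists_length_quotient_pow_le hdim _ hJ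
  -- The length of `R / F(Ke)` with `K = m + c * j + j`, bounded from below and from above.
  have key : ∀ j : ℕ, j * j ^ d ≤ C * (m + c * j + j) ^ d := by
    intro j
    have h1 := mul_le_relLength_of_le_hilbert (F := F) (N := m + c * j) (a := (j ^ d : ℕ))
      (fun n hn => by
        have := hmc j (fun _ => (n : ℤ)) fun k => by exact_mod_cast hn
        rwa [hl] at this) j
    have h2 : (∏ i, I i) ^ (m + c * j + j) ≤ F fun _ => ((m + c * j + j : ℕ) : ℤ) :=
      multiPow_const I _ ▸ F.multiPow_le' _
    have h3 := (h1.trans (Ideal.relLength_anti le_top h2)).trans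
      ((Ideal.top_relLength _).le.trans (hC _))
    exact_mod_cast h3
  -- `m + c * j + j ≤ (m + c + 1) * j` for `j ≥ 1`, so the inequality forces `j ≤ B`.
  set B := C * (m + c + 1) ^ d with hB
  have h1 := key (B + 1)
  have h2 : m + c * (B + 1) + (B + 1) ≤ (m + c + 1) * (B + 1) := by nlinarith
  have h3 : C * (m + c * (B + 1) + (B + 1)) ^ d ≤ B * (B + 1) ^ d := by
    rw [hB, mul_assoc, ← mul_pow]
    exact Nat.mul_le_mul_left _ (Nat.pow_le_pow_left h2 d)
  have h4 : 0 < (B + 1) ^ d := by positivity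
  exact absurd (Nat.le_of_mul_le_mul_right (h1.trans h3) h4) (by omega)

theorem mul_relIdeal_le (F : MultiFiltration I) (l : List (Σ i, I i)) (i : Fin s)
    (n : Fin s → ℤ) : I i * F.relIdeal l n ≤ F.relIdeal l (n + Pi.single i 1) := by
  have hF : ∀ n, I i * F n ≤ F (n + Pi.single i 1) := fun n =>
    (Ideal.mul_mono_left (F.le_toFun_single i)).trans
      ((F.mul_le' _ _).trans (le_of_eq (by rw [add_comm])))
  unfold relIdeal
  rw [Ideal.mul_sup]
  refine sup_le_sup ((hF _).trans (le_of_eq (by rw [add_right_comm]))) ?_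
  simp only [Ideal.mul_iSup]
  refine iSup₂_mono fun p _ => ?_
  rw [mul_left_comm]
  exact Ideal.mul_mono_right ((hF _).trans (le_of_eq (by rw [sub_add_eq_add_sub])))

/-- The elements of a list of `dim R` successively regular elements satisfy the defining equations
of a joint reduction: `F(n) = relIdeal l n` propagates from one large degree to all larger ones, and
the summand `F(n + e)` of `relIdeal l n` is absorbed by Nakayama's lemma. -/
theorem IsAdmissible.exists_le_iSup [IsLocalRing R] [IsNoetherianRing R] {d : ℕ}
    (hdim : ringKrullDim R = d) (hs : 0 < s)
    (hI : ∀ i, (I i).radical = IsLocalRing.maximalIdeal R)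
    {F : MultiFiltration I} (hF : F.IsAdmissible) {l : List (Σ i, I i)} (hl : l.length = d)
    (hreg : ∀ l₁ p l₃, l = l₁ ++ p :: l₃ → F.IsEventuallyRegular l₁ p) :
    ∃ m : Fin s → ℕ, ∀ n : Fin s → ℤ, (fun k => (m k : ℤ)) ≤ n →
      F n ≤ ⨆ p ∈ l, Ideal.span {(p.2 : R)} * F (n - Pi.single p.1 1) := by
  obtain ⟨D, hD⟩ := hF.exists_forall_le_mul
  obtain ⟨n₀, hn₀, hle⟩ := F.exists_le_relIdeal hdim hs hI hl hreg D
  have hup : ∀ p : Fin s → ℕ, F (n₀ + fun k => (p k : ℤ)) ≤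
      F.relIdeal l (n₀ + fun k => (p k : ℤ)) := by
    intro p
    induction p using Pi.natInduction with
    | h p ih =>
      by_cases hp : p = 0
      · subst hp
        have h0 : (n₀ + fun k => (((0 : Fin s → ℕ) k : ℕ) : ℤ)) = n₀ := by
          ext k
          simp
        rwa [h0]
      · obtain ⟨i, hi⟩ := Function.ne_iff.1 hp
        obtain ⟨q, rfl⟩ := Pi.exists_eq_single_add hi
        have heq : (n₀ + fun k => (((Pi.single i 1 + q : Fin s → ℕ) k : ℕ) : ℤ)) =
            (n₀ + fun k => (q k : ℤ)) + Pi.single i 1 := by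
          ext k
          by_cases hk : k = i
          · subst hk; simp; ring
          · simp [hk]
        rw [heq]
        refine (hD _ i ?_).trans ((Ideal.mul_mono_right (ih i q rfl)).trans
          (F.mul_relIdeal_le l i _))
        have := hn₀ i
        simp only [Pi.add_apply]
        omega
  refine ⟨fun k => (n₀ k).toNat, fun n hn => ?_⟩
  have hn' : ∀ k, n₀ k ≤ n k := fun k => (Int.self_le_toNat _).trans (hn k)
  have h1 : F n ≤ F.relIdeal l n := by
    have := hup fun k => (n k - n₀ k).toNat
    have heq : (n₀ + fun k => (((n k - n₀ k).toNat : ℕ) : ℤ)) = n := by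
      ext k
      have := hn' k
      simp only [Pi.add_apply]
      omega
    rwa [heq] at this
  let i : Fin s := ⟨0, hs⟩
  have hsingle : (Pi.single i 1 : Fin s → ℤ) ≤ 1 := by
    intro k
    by_cases hk : k = i
    · subst hk; simp
    · simp [hk]
  have h2 : F (n + 1) ≤ IsLocalRing.maximalIdeal R * F n :=
    (F.anti' _ _ (add_le_add_right hsingle n)).trans
      ((hD n i ((hn₀ i).trans (hn' i))).trans (Ideal.mul_mono_left ((hI i) ▸ Ideal.le_radical)))
  refine Submodule.le_of_le_smul_of_le_jacobson_bot (IsNoetherian.noetherian _)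
    (IsLocalRing.maximalIdeal_le_jacobson _) (h1.trans (sup_le ?_ le_sup_left))
  exact h2.trans le_sup_right

theorem isJointReduction_of_le_iSup {F : MultiFiltration I} {q : Fin s → ℕ}
    {a : ∀ i, Fin (q i) → I i} {l : List (Σ i, I i)} (hl : ∀ p ∈ l, ∃ i j, p = ⟨i, a i j⟩)
    {m : Fin s → ℕ} (hm : ∀ n : Fin s → ℤ, (fun k => (m k : ℤ)) ≤ n →
      F n ≤ ⨆ p ∈ l, Ideal.span {(p.2 : R)} * F (n - Pi.single p.1 1)) :
    F.IsJointReduction q a := by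
  refine ⟨m, fun n hn => le_antisymm ?_ ((hm n hn).trans (iSup₂_le fun p hp => ?_))⟩
  · simp only [Ideal.sum_eq_sup]
    exact Finset.sup_le fun i _ => Finset.sup_le fun j _ => F.span_mul_le ⟨i, a i j⟩ n
  · obtain ⟨i, j, rfl⟩ := hl p hp
    simp only [Ideal.sum_eq_sup]
    let G : ∀ i, Fin (q i) → Ideal R := fun i j =>
      Ideal.span {(a i j : R)} * F (n - Pi.single i 1)
    exact (Finset.le_sup (f := G i) (Finset.mem_univ j)).trans
      (Finset.le_sup (f := fun i => Finset.univ.sup (G i)) (Finset.mem_univ i))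

/-- Filter-regular forms are chosen one after the other, each modulo the previous ones; the elements
are indexed by a type `κ` whose members prescribe the ideals to choose from. -/
theorem IsAdmissible.exists_isFilterRegularSequence [IsLocalRing R] [IsNoetherianRing R]
    (hres : Infinite (IsLocalRing.ResidueField R)) {F : MultiFiltration I} (hF : F.IsAdmissible)
    {κ : Type*} (ι : κ → Fin s) (l : List κ) (hl : l.Nodup) :
    ∃ a : ∀ k, I (ι k), IsFilterRegularSequence (ringComponent I) F.moduleComponent
      (l.map fun k => initialForm I (ι k) (a k)) := by
  classical
  induction l using List.reverseRecOn with
  | nil => exact ⟨0, fun k hk => absurd hk (Nat.not_lt_zero _)⟩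
  | append_singleton l x ih =>
    obtain ⟨hl', hx⟩ : l.Nodup ∧ x ∉ l := by
      rw [List.nodup_append] at hl
      exact ⟨hl.1, fun hx => hl.2.2 x hx x (List.mem_singleton_self x) rfl⟩
    obtain ⟨a, ha⟩ := ih hl'
    obtain ⟨b, hb⟩ := hF.exists_isFilterRegular_initialForm hres
      (Ideal.ofList (l.map fun k => initialForm I (ι k) (a k)) • ⊤) (ι x)
    refine ⟨Function.update a x b, ?_⟩
    have hmap : ((l ++ [x]).map fun k => initialForm I (ι k) (Function.update a x b k)) =
        (l.map fun k => initialForm I (ι k) (a k)) ++ [initialForm I (ι x) b] := by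
      rw [List.map_append, List.map_singleton, Function.update_self]
      congr 1
      refine List.map_congr_left fun k hk => ?_
      rw [Function.update_of_ne (ne_of_mem_of_not_mem hk hx)]
    rw [hmap]
    intro k hk
    rw [List.length_append, List.length_singleton] at hk
    rcases (Nat.lt_succ_iff_lt_or_eq.1 hk) with hk | rfl
    · rw [List.take_append_of_le_length hk.le, List.getElem_append_left hk]
      exact ha k hk
    · rw [List.take_left', List.getElem_concat_length]
      · exact hb
      · rfl
      · rfl

end MultiFiltration

theorem mainTheorem5 {R : Type*} [CommRing R] [IsLocalRing R] [IsNoetherianRing R]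
    (hres : Infinite (IsLocalRing.ResidueField R))
    (d : ℕ) (hd : 1 ≤ d) (hdim : ringKrullDim R = d)
    {s : ℕ} (I : Fin s → Ideal R)
    (hI : ∀ i, (I i).radical = IsLocalRing.maximalIdeal R)
    (F : MultiFiltration I) (hF : F.IsAdmissible)
    (q : Fin s → ℕ) (hq : ∑ i, q i = d) :
    ∃ a : ∀ i, Fin (q i) → I i,
      F.IsJointReduction q a ∧
      IsFilterRegularSequence (MultiFiltration.ringComponent I) F.moduleComponent
        (List.ofFn fun i =>
          List.ofFn fun j => MultiFiltration.initialForm I i (a i j)).flatten := by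
  have hs : 0 < s := by
    rcases Nat.eq_zero_or_pos s with rfl | hs
    · simp at hq
      omega
    · exact hs
  let L : List (Σ i, Fin (q i)) := (List.ofFn fun i => List.ofFn fun j => ⟨i, j⟩).flatten
  have hL : L.Nodup := by
    refine List.nodup_flatten.2 ⟨fun l hl => ?_, ?_⟩
    · obtain ⟨i, rfl⟩ := List.mem_ofFn.1 hl
      exact List.nodup_ofFn.2 fun j k hjk => by simpa using hjk
    · rw [List.pairwise_ofFn]
      intro i j hij x hx hx'
      obtain ⟨_, rfl⟩ := List.mem_ofFn.1 hx
      obtain ⟨_, h⟩ := List.mem_ofFn.1 hx'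
      exact hij.ne (congrArg Sigma.fst h).symm
  obtain ⟨b, hb⟩ := hF.exists_isFilterRegularSequence hres Sigma.fst L hL
  let l : List (Σ i, I i) := L.map fun k => ⟨k.1, b k⟩
  have hl : l.length = d := by
    rw [List.length_map, List.length_flatten, List.map_ofFn, List.sum_ofFn, ← hq]
    simp
  have hreg : ∀ l₁ p l₃, l = l₁ ++ p :: l₃ → F.IsEventuallyRegular l₁ p := by
    intro l₁ p l₃ h
    refine MultiFiltration.isEventuallyRegular_of_isFilterRegular ?_
    have hmap : (L.map fun k => MultiFiltration.initialForm I k.1 (b k)) =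
        (l₁.map fun p => MultiFiltration.initialForm I p.1 p.2) ++
          MultiFiltration.initialForm I p.1 p.2 ::
            l₃.map fun p => MultiFiltration.initialForm I p.1 p.2 := by
      rw [← List.map_cons (f := fun p : Σ i, I i => MultiFiltration.initialForm I p.1 p.2),
        ← List.map_append, ← h, List.map_map]
      rfl
    rw [hmap] at hb
    have := hb l₁.length (by simp)
    rw [List.take_left' (by simp)] at this
    simp only [List.length_map, le_refl, List.getElem_append_right,
      Nat.sub_self, List.getElem_cons_zero] at this
    exact this
  refine ⟨fun i j => b ⟨i, j⟩, ?_, ?_⟩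
  · obtain ⟨m, hm⟩ := hF.exists_le_iSup hdim hs hI hl hreg
    refine MultiFiltration.isJointReduction_of_le_iSup (l := l) (fun p hp => ?_) hm
    obtain ⟨⟨i, j⟩, -, rfl⟩ := List.mem_map.1 hp
    exact ⟨i, j, rfl⟩
  · convert! hb using 1
    simp only [L, List.map_flatten, List.map_ofFn, Function.comp_def]
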